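/- Let $(W,S)$ be a Coxeter group with $S$ finite; for $J\subseteq S$ let $W_J=\langle J\rangle$. Graphs are taken in the sense of Serre: oriented edges $e$ with origin $o(e)$, terminus $t(e)$ and a fixed-point-free inversion $e\mapsto\bar e$ with $\bar{\bar e}=e$ and $o(\bar e)=t(e)$; a tree is a non-empty connected graph without circuits. Let $\Delta=(\mathcal C,\delta)$ be a building of type $(W,S)$ with (non-empty) set of chambers $\mathcal C$ and Weyl distance $\delta\colon\mathcal C\times\mathcal C\to W$, and for $J\subseteq S$, $c\in\mathcal C$ put $\mathrm{Res}_J(c)=\{d\in\mathcal C\mid \delta(c,d)\in W_J\}$. Let $(\mathcal G,\Lambda)$ be a graph of special subgroups of $(W,S)$, i.e. $\Lambda$ is a non-empty connected graph with vertex set $\mathscr V(\Lambda)$ and edge set $\mathscr E(\Lambda)$, each $\lambda\in\mathscr V(\Lambda)\sqcup\mathscr E(\Lambda)$ is assigned a subset $S_\lambda\subseteq S$ and the group $\mathcal G_\lambda=W_{S_\lambda}$, with $S_{\bar e}=S_e\subseteq S_{t(e)}$ for every edge $e$, and the monomorphisms $\mathcal G_e\hookrightarrow\mathcal G_{t(e)}$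 are the inclusions. Fix a vertex $x_0$ of $\Lambda$. The fundamental group $\pi_1(\mathcal G,\Lambda,x_0)$ consists of the elements $r_0e_1r_1\cdots e_nr_n$, where $n\ge 0$, $(e_1,\dots,e_n)$ is a closed path at $x_0$, $r_0\in\mathcal G_{x_0}$ and $r_i\in \mathcal G_{t(e_i)}$ for $1\le i\le n$, of the group generated by all vertex groups and all edges of $\Lambda$ subject to the relations $\bar e=e^{-1}$ and $e\,a\,e^{-1}=a$ for $e\in\mathscr E(\Lambda)$ and $a\in\mathcal G_e$ (with the left-hand $a$ taken in $\mathcal G_{t(e)}$ and the right-hand one in $\mathcal G_{o(e)}$). The pair $(\mathcal G,\Lambda)$ is a visual graph of groups decomposition of $(W,S)$ if the homomorphism $\tau\colon\pi_1(\mathcal G,\Lambda,x_0)\to W$, $r_0e_1r_1\cdots e_nr_n\mapsto r_0r_1\cdots r_n$, induced by the inclusions $W_{S_\lambda}\hookrightarrow W$, is an isomorphism. Let $\Gamma^\Delta_{(\mathcal G,\Lambda)}(\mathcal C)$ be the graph with vertex set $\bigsqcup_{v\in\mathscr V(\Lambda)}\{\mathrm{Res}_{S_v}(c)\mid c\in\mathcal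 C\}$ and edge set $\bigsqcup_{e\in\mathscr E(\Lambda)}\{\mathrm{Res}_{S_e}(c)\mid c\in\mathcal C\}$, in which for every $e\in\mathscr E(\Lambda)$ and $c\in\mathcal C$ the edge $\mathrm{Res}_{S_e}(c)$ in the copy indexed by $e$ has origin $\mathrm{Res}_{S_{o(e)}}(c)$, terminus $\mathrm{Res}_{S_{t(e)}}(c)$ and inverse $\mathrm{Res}_{S_{\bar e}}(c)$ in the copy indexed by $\bar e$. Then the following are equivalent: (i) $(\mathcal G,\Lambda)$ is a visual graph of groups decomposition of $(W,S)$; (ii) $S=\bigcup_{v\in\mathscr V(\Lambda)}S_v$ and $\Gamma^\Delta_{(\mathcal G,\Lambda)}(\mathcal C)$ is a tree. -/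

import Mathlib

universe u₁ u₂ u₃ u₄ u₅

/-! ### Graphs in the sense of Serre -/

/-- A graph in the sense of Serre: oriented edges with a fixed-point-free involution
reversing the orientation. Loops and multiple edges are allowed. -/
structure SerreGraph (V : Type u₁) (E : Type u₂) where
  origin : E → V
  terminus : E → V
  inv : E → E
  inv_inv : ∀ e, inv (inv e) = e
  inv_ne : ∀ e, inv e ≠ e
  origin_inv : ∀ e, origin (inv e) = terminus e

namespace SerreGraph

variable {V : Type u₁} {E : Type u₂} (G : SerreGraph V E)

theorem terminus_inv (e : E) : G.terminus (G.inv e) = G.origin e := by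
  rw [← G.origin_inv, G.inv_inv]

/-- The list of edges `p` is a path from `u` to `v`. -/
def IsPath : V → List E → V → Prop
  | u, [], v => u = v
  | u, e :: p, v => G.origin e = u ∧ IsPath (G.terminus e) p v

/-- A graph is connected if it is non-empty and any two vertices are joined by a path. -/
def Connected : Prop :=
  Nonempty V ∧ ∀ u v, ∃ p, G.IsPath u p v

/-- A circuit: a closed path `(e₁, …, eₙ)` with `n ≥ 1` and without backtracking whose vertices
`t(e₁), …, t(eₙ)` are pairwise distinct. (Loops are the circuits of length one.) -/
def IsCircuit (p : List E) : Prop :=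
  p ≠ [] ∧ (∃ u, G.IsPath u p u) ∧ p.IsChain (fun e f => f ≠ G.inv e) ∧
    (p.map G.terminus).Nodup

/-- A tree is a connected (non-empty) graph without circuits. -/
def IsTree : Prop :=
  G.Connected ∧ ∀ p, ¬ G.IsCircuit p

end SerreGraph

/-! ### Special subgroups and buildings -/

section Buildings

variable {B : Type u₁} {W : Type u₂} [Group W] {M : CoxeterMatrix B}

/-- The special subgroup `W_J` generated by the simple reflections with index in `J`. -/
def specialSubgroup (cs : CoxeterSystem M W) (J : Set B) : Subgroup W :=
  Subgroup.closure (cs.simple '' J)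

theorem specialSubgroup_mono (cs : CoxeterSystem M W) {J K : Set B} (h : J ⊆ K) :
    specialSubgroup cs J ≤ specialSubgroup cs K :=
  Subgroup.closure_mono (Set.image_mono h)

/-- A building of type `(W, S)` with set of chambers `C`, given by its Weyl distance `δ`.
For a simple reflection `s`, the `s`-adjacency relation is `δ c d ∈ {1, s}`. -/
structure Building (cs : CoxeterSystem M W) (C : Type u₃) where
  δ : C → C → W
  nonempty : Nonempty C
  δ_eq_one_iff : ∀ c d, δ c d = 1 ↔ c = d
  δ_of_adj : ∀ (i : B) (c' c d : C), δ c' c = cs.simple i →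
    δ c' d = cs.simple i * δ c d ∨ δ c' d = δ c d
  δ_of_adj_of_length : ∀ (i : B) (c' c d : C), δ c' c = cs.simple i →
    cs.length (cs.simple i * δ c d) = cs.length (δ c d) + 1 →
    δ c' d = cs.simple i * δ c d
  exists_adj : ∀ (i : B) (c d : C),
    ∃ c', δ c' c = cs.simple i ∧ δ c' d = cs.simple i * δ c d

namespace Building

variable {cs : CoxeterSystem M W} {C : Type u₃} (Δ : Building cs C)

/-- The residue `Res_J(c)`. -/
def Res (J : Set B) (c : C) : Set C :=
  {d | Δ.δ c d ∈ specialSubgroup cs J}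

theorem mem_Res_self (J : Set B) (c : C) : c ∈ Δ.Res J c := by
  have h : Δ.δ c c = 1 := (Δ.δ_eq_one_iff c c).2 rfl
  simp [Res, h, one_mem]

theorem Res_eq_of_δ_mem {J : Set B} {c d : C} (h : Δ.δ c d ∈ specialSubgroup cs J) :
    Δ.Res J c = Δ.Res J d := by
  have step : ∀ (i : B), i ∈ J → ∀ w : W, (∀ c, Δ.δ c d = w → Δ.Res J c = Δ.Res J d) →
      ∀ c, Δ.δ c d = cs.simple i * w → Δ.Res J c = Δ.Res J d := by
    intro i hi w ih c hc
    obtain ⟨c', h1, h2⟩ := Δ.exists_adj i c d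
    have hs : cs.simple i ∈ specialSubgroup cs J :=
      Subgroup.subset_closure (Set.mem_image_of_mem _ hi)
    rw [← ih c' (by rw [h2, hc, cs.simple_mul_simple_cancel_left])]
    ext x
    change Δ.δ c x ∈ specialSubgroup cs J ↔ Δ.δ c' x ∈ specialSubgroup cs J
    rcases Δ.δ_of_adj i c' c x h1 with h | h
    · rw [h]
      exact ((specialSubgroup cs J).mul_mem_cancel_left hs).symm
    · rw [h]
  have key : ∀ w ∈ specialSubgroup cs J, ∀ c, Δ.δ c d = w → Δ.Res J c = Δ.Res J d := by
    intro w hw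
    induction hw using Subgroup.closure_induction_left with
    | one =>
      intro c hc
      rw [(Δ.δ_eq_one_iff c d).1 hc]
    | mul_left x hx y hy ih =>
      obtain ⟨i, hi, rfl⟩ := hx
      exact step i hi y ih
    | inv_mul_cancel x hx y hy ih =>
      obtain ⟨i, hi, rfl⟩ := hx
      rw [cs.inv_simple]
      exact step i hi y ih
  exact key _ h c rfl

theorem Res_eq_iff {J : Set B} {c d : C} :
    Δ.Res J c = Δ.Res J d ↔ Δ.δ c d ∈ specialSubgroup cs J := by
  refine ⟨fun h => ?_, Δ.Res_eq_of_δ_mem⟩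
  have := Δ.mem_Res_self J d
  rwa [← h] at this

/-- The set `R_J(N) = {Res_J(c) | c ∈ N}`. -/
def residues (J : Set B) (N : Set C) : Set (Set C) :=
  Δ.Res J '' N

/-- The union of all `K`-residues that meet `R`; for `J ⊆ K` it sends `Res_J(c)` to `Res_K(c)`,
see `enlarge_Res`. -/
def enlarge (K : Set B) (R : Set C) : Set C :=
  ⋃ c ∈ R, Δ.Res K c

theorem enlarge_Res {J K : Set B} (h : J ⊆ K) (c : C) :
    Δ.enlarge K (Δ.Res J c) = Δ.Res K c := by
  apply Set.Subset.antisymm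
  · refine Set.iUnion₂_subset fun d hd => ?_
    rw [Δ.Res_eq_of_δ_mem (specialSubgroup_mono cs h hd)]
  · exact Set.subset_iUnion₂_of_subset c (Δ.mem_Res_self J c) subset_rfl

theorem enlarge_mem_residues {J K : Set B} (h : J ⊆ K) {N : Set C} {R : Set C}
    (hR : R ∈ Δ.residues J N) : Δ.enlarge K R ∈ Δ.residues K N := by
  obtain ⟨c, hc, rfl⟩ := hR
  exact ⟨c, hc, (Δ.enlarge_Res h c).symm⟩

end Building

end Buildings

/-! ### Graphs of special subgroups -/

/-- A graph of special subgroups based on the connected graph `Λ`: to every vertex and every edge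
a subset of `S` is assigned, so that `S_ē = S_e` and `S_e ⊆ S_{t(e)}`. The group at `x` is
`W_{S_x}`, and the monomorphisms of the edge groups into the vertex groups are the inclusions. -/
structure SpecialGraph (B : Type u₁) {V : Type u₂} {E : Type u₃} (Λ : SerreGraph V E) where
  connected : Λ.Connected
  vset : V → Set B
  eset : E → Set B
  eset_inv : ∀ e, eset (Λ.inv e) = eset e
  eset_subset : ∀ e, eset e ⊆ vset (Λ.terminus e)

namespace SpecialGraph

variable {B : Type u₁} {W : Type u₂} [Group W] {M : CoxeterMatrix B}
  {V : Type u₃} {E : Type u₄} {Λ : SerreGraph V E}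

theorem eset_subset_origin (𝒢 : SpecialGraph B Λ) (e : E) :
    𝒢.eset e ⊆ 𝒢.vset (Λ.origin e) := by
  have h := 𝒢.eset_subset (Λ.inv e)
  rwa [𝒢.eset_inv, Λ.terminus_inv] at h

/-! #### The fundamental group -/

/-- The free product of all vertex groups and of the free group on the edges of `Λ`. -/
abbrev FreeProd (𝒢 : SpecialGraph B Λ) (cs : CoxeterSystem M W) : Type _ :=
  Monoid.Coprod (Monoid.CoprodI fun v : V => specialSubgroup cs (𝒢.vset v)) (FreeGroup E)

/-- The element `a` of the vertex group at `v`, inside the free product. -/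
def preVertex (𝒢 : SpecialGraph B Λ) (cs : CoxeterSystem M W) (v : V)
    (a : specialSubgroup cs (𝒢.vset v)) : 𝒢.FreeProd cs :=
  Monoid.Coprod.inl
    (Monoid.CoprodI.of (M := fun v : V => specialSubgroup cs (𝒢.vset v)) (i := v) a)

/-- The generator attached to the edge `e`, inside the free product. -/
def preEdge (𝒢 : SpecialGraph B Λ) (cs : CoxeterSystem M W) (e : E) : 𝒢.FreeProd cs :=
  Monoid.Coprod.inr (FreeGroup.of e)

/-- The relators expressing `ē = e⁻¹`, and `e a e⁻¹ = a` for `a` in the edge group of `e`, where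
the first `a` is taken in the vertex group at `t(e)` and the second in that at `o(e)`. -/
def relators (𝒢 : SpecialGraph B Λ) (cs : CoxeterSystem M W) : Set (𝒢.FreeProd cs) :=
  {x | ∃ e, x = 𝒢.preEdge cs (Λ.inv e) * 𝒢.preEdge cs e} ∪
  {x | ∃ (e : E) (a : W) (ha : a ∈ specialSubgroup cs (𝒢.eset e)),
    x = 𝒢.preEdge cs e *
      𝒢.preVertex cs (Λ.terminus e) ⟨a, specialSubgroup_mono cs (𝒢.eset_subset e) ha⟩ *
      (𝒢.preEdge cs e)⁻¹ *
      (𝒢.preVertex cs (Λ.origin e)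
        ⟨a, specialSubgroup_mono cs (𝒢.eset_subset_origin e) ha⟩)⁻¹}

/-- The group `F(𝒢, Λ)` generated by the vertex groups and the edges, subject to `relators`. -/
abbrev PathGroup (𝒢 : SpecialGraph B Λ) (cs : CoxeterSystem M W) : Type _ :=
  𝒢.FreeProd cs ⧸ Subgroup.normalClosure (𝒢.relators cs)

/-- The element of `F(𝒢, Λ)` given by the element `a` of the vertex group at `v`. -/
def vertexElt (𝒢 : SpecialGraph B Λ) (cs : CoxeterSystem M W) (v : V)
    (a : specialSubgroup cs (𝒢.vset v)) : 𝒢.PathGroup cs :=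
  QuotientGroup.mk (𝒢.preVertex cs v a)

/-- The element of `F(𝒢, Λ)` given by the edge `e`. -/
def edgeElt (𝒢 : SpecialGraph B Λ) (cs : CoxeterSystem M W) (e : E) : 𝒢.PathGroup cs :=
  QuotientGroup.mk (𝒢.preEdge cs e)

theorem vertexElt_one (𝒢 : SpecialGraph B Λ) (cs : CoxeterSystem M W) (v : V) :
    𝒢.vertexElt cs v 1 = 1 := by
  simp [vertexElt, preVertex]

theorem vertexElt_mul (𝒢 : SpecialGraph B Λ) (cs : CoxeterSystem M W) (v : V)
    (a b : specialSubgroup cs (𝒢.vset v)) :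
    𝒢.vertexElt cs v (a * b) = 𝒢.vertexElt cs v a * 𝒢.vertexElt cs v b := by
  simp [vertexElt, preVertex]

theorem vertexElt_inv (𝒢 : SpecialGraph B Λ) (cs : CoxeterSystem M W) (v : V)
    (a : specialSubgroup cs (𝒢.vset v)) :
    𝒢.vertexElt cs v a⁻¹ = (𝒢.vertexElt cs v a)⁻¹ := by
  rw [eq_inv_iff_mul_eq_one, ← vertexElt_mul, inv_mul_cancel, vertexElt_one]

theorem edgeElt_inv (𝒢 : SpecialGraph B Λ) (cs : CoxeterSystem M W) (e : E) :
    𝒢.edgeElt cs (Λ.inv e) = (𝒢.edgeElt cs e)⁻¹ := by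
  rw [eq_inv_iff_mul_eq_one]
  exact (QuotientGroup.eq_one_iff _).2 (Subgroup.subset_normalClosure (Or.inl ⟨e, rfl⟩))

/-- `IsPathWord u v x` says that `x = r₀ e₁ r₁ e₂ ⋯ eₙ rₙ` in `F(𝒢, Λ)` for some path
`(e₁, …, eₙ)` from `u` to `v`, `n ≥ 0`, where `rᵢ` lies in the group of its `i`-th vertex. -/
inductive IsPathWord (𝒢 : SpecialGraph B Λ) (cs : CoxeterSystem M W) :
    V → V → 𝒢.PathGroup cs → Prop
  | nil (v : V) (a : specialSubgroup cs (𝒢.vset v)) : IsPathWord 𝒢 cs v v (𝒢.vertexElt cs v a)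
  | cons (e : E) (a : specialSubgroup cs (𝒢.vset (Λ.origin e))) (w : V) (x : 𝒢.PathGroup cs)
      (h : IsPathWord 𝒢 cs (Λ.terminus e) w x) :
      IsPathWord 𝒢 cs (Λ.origin e) w (𝒢.vertexElt cs (Λ.origin e) a * 𝒢.edgeElt cs e * x)

theorem IsPathWord.vertexElt_mul {𝒢 : SpecialGraph B Λ} {cs : CoxeterSystem M W} {u v : V}
    {x : 𝒢.PathGroup cs} (h : 𝒢.IsPathWord cs u v x) (a : specialSubgroup cs (𝒢.vset u)) :
    𝒢.IsPathWord cs u v (𝒢.vertexElt cs u a * x) := by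
  cases h with
  | nil b =>
    rw [← SpecialGraph.vertexElt_mul]
    exact .nil _ _
  | cons e b _ y hy =>
    rw [← mul_assoc, ← mul_assoc, ← SpecialGraph.vertexElt_mul]
    exact .cons e _ _ _ hy

theorem IsPathWord.mul {𝒢 : SpecialGraph B Λ} {cs : CoxeterSystem M W} {u v w : V}
    {x y : 𝒢.PathGroup cs} (hx : 𝒢.IsPathWord cs u v x) (hy : 𝒢.IsPathWord cs v w y) :
    𝒢.IsPathWord cs u w (x * y) := by
  induction hx with
  | nil v a => exact hy.vertexElt_mul a
  | cons e a v x h ih =>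
    rw [mul_assoc]
    exact .cons e a _ _ (ih hy)

theorem IsPathWord.edge_inv (𝒢 : SpecialGraph B Λ) (cs : CoxeterSystem M W) (e : E) :
    𝒢.IsPathWord cs (Λ.terminus e) (Λ.origin e) (𝒢.edgeElt cs e)⁻¹ := by
  have h := IsPathWord.cons (𝒢 := 𝒢) (cs := cs) (Λ.inv e) 1 _ _ (.nil _ 1)
  rw [vertexElt_one, vertexElt_one, one_mul, mul_one, edgeElt_inv] at h
  rwa [Λ.origin_inv, Λ.terminus_inv] at h

theorem IsPathWord.inv {𝒢 : SpecialGraph B Λ} {cs : CoxeterSystem M W} {u v : V}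
    {x : 𝒢.PathGroup cs} (hx : 𝒢.IsPathWord cs u v x) : 𝒢.IsPathWord cs v u x⁻¹ := by
  induction hx with
  | nil v a =>
    rw [← vertexElt_inv]
    exact .nil _ _
  | cons e a v x h ih =>
    rw [mul_inv_rev, mul_inv_rev, ← vertexElt_inv]
    exact ih.mul ((IsPathWord.edge_inv 𝒢 cs e).mul (.nil _ _))

/-- The fundamental group `π₁(𝒢, Λ, x₀)`: the subgroup of `F(𝒢, Λ)` of all elements represented
by words along closed paths at `x₀`. -/
def fundamentalGroup (𝒢 : SpecialGraph B Λ) (cs : CoxeterSystem M W) (x₀ : V) :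
    Subgroup (𝒢.PathGroup cs) where
  carrier := {x | 𝒢.IsPathWord cs x₀ x₀ x}
  mul_mem' := fun hx hy => IsPathWord.mul hx hy
  one_mem' := by
    have h := IsPathWord.nil (𝒢 := 𝒢) (cs := cs) x₀ 1
    rwa [vertexElt_one] at h
  inv_mem' := fun hx => IsPathWord.inv hx

/-- The homomorphism from the free product to `W` that is the inclusion on every vertex group and
trivial on the edges. -/
def preTau (𝒢 : SpecialGraph B Λ) (cs : CoxeterSystem M W) : 𝒢.FreeProd cs →* W :=
  Monoid.Coprod.lift
    (Monoid.CoprodI.lift fun v : V => (specialSubgroup cs (𝒢.vset v)).subtype) 1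

theorem preTau_preVertex (𝒢 : SpecialGraph B Λ) (cs : CoxeterSystem M W) (v : V)
    (a : specialSubgroup cs (𝒢.vset v)) : 𝒢.preTau cs (𝒢.preVertex cs v a) = a := by
  simp [preTau, preVertex]

theorem preTau_preEdge (𝒢 : SpecialGraph B Λ) (cs : CoxeterSystem M W) (e : E) :
    𝒢.preTau cs (𝒢.preEdge cs e) = 1 := by
  simp [preTau, preEdge]

theorem normalClosure_relators_le_ker (𝒢 : SpecialGraph B Λ) (cs : CoxeterSystem M W) :
    Subgroup.normalClosure (𝒢.relators cs) ≤ (𝒢.preTau cs).ker := by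
  refine Subgroup.normalClosure_le_normal ?_
  rintro x (⟨e, rfl⟩ | ⟨e, a, ha, rfl⟩)
  · simp [MonoidHom.mem_ker, preTau_preEdge]
  · simp [MonoidHom.mem_ker, preTau_preEdge, preTau_preVertex]

/-- The homomorphism `F(𝒢, Λ) → W` induced by the inclusions of the vertex groups. -/
def pathTau (𝒢 : SpecialGraph B Λ) (cs : CoxeterSystem M W) : 𝒢.PathGroup cs →* W :=
  QuotientGroup.lift _ (𝒢.preTau cs) (𝒢.normalClosure_relators_le_ker cs)

/-- The homomorphism `τ : π₁(𝒢, Λ, x₀) → W`, sending `r₀ e₁ r₁ ⋯ eₙ rₙ` to `r₀ r₁ ⋯ rₙ`. -/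
def tau (𝒢 : SpecialGraph B Λ) (cs : CoxeterSystem M W) (x₀ : V) :
    𝒢.fundamentalGroup cs x₀ →* W :=
  (𝒢.pathTau cs).comp (𝒢.fundamentalGroup cs x₀).subtype

/-- `(𝒢, Λ)` is a visual graph of groups decomposition of `(W, S)`: the homomorphism
`τ : π₁(𝒢, Λ, x₀) → W` is an isomorphism. -/
def IsVisualDecomposition (𝒢 : SpecialGraph B Λ) (cs : CoxeterSystem M W) (x₀ : V) : Prop :=
  Function.Bijective (𝒢.tau cs x₀)

/-! #### The residue graph -/

variable {cs : CoxeterSystem M W} {C : Type u₅}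

/-- The vertices of the residue graph: the disjoint union over `v` of the sets `R_{S_v}(N)`. -/
abbrev ResidueVertex (𝒢 : SpecialGraph B Λ) (Δ : Building cs C) (N : Set C) : Type _ :=
  Σ v : V, Δ.residues (𝒢.vset v) N

/-- The edges of the residue graph: the disjoint union over `e` of the sets `R_{S_e}(N)`. -/
abbrev ResidueEdge (𝒢 : SpecialGraph B Λ) (Δ : Building cs C) (N : Set C) : Type _ :=
  Σ e : E, Δ.residues (𝒢.eset e) N

theorem residue_sigma_ext {ι : Type*} {C : Type*} {P : ι → Set (Set C)} {i j : ι} {a b : Set C}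
    {ha : a ∈ P i} {hb : b ∈ P j} (h₁ : i = j) (h₂ : a = b) :
    (⟨i, a, ha⟩ : Σ i, P i) = ⟨j, b, hb⟩ := by
  cases h₁
  cases h₂
  rfl

/-- The residue graph `Γ(N)` of a set `N` of chambers, where `o`, `t` and the inversion send the
edge `Res_{S_e}(c)` to `Res_{S_{o(e)}}(c)`, `Res_{S_{t(e)}}(c)` and the edge `Res_{S_ē}(c)`. -/
def residueGraph (𝒢 : SpecialGraph B Λ) (Δ : Building cs C) (N : Set C) :
    SerreGraph (𝒢.ResidueVertex Δ N) (𝒢.ResidueEdge Δ N) where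
  origin x := ⟨Λ.origin x.1, Δ.enlarge (𝒢.vset (Λ.origin x.1)) x.2,
    Δ.enlarge_mem_residues (𝒢.eset_subset_origin x.1) x.2.2⟩
  terminus x := ⟨Λ.terminus x.1, Δ.enlarge (𝒢.vset (Λ.terminus x.1)) x.2,
    Δ.enlarge_mem_residues (𝒢.eset_subset x.1) x.2.2⟩
  inv x := ⟨Λ.inv x.1, x.2, by rw [𝒢.eset_inv]; exact x.2.2⟩
  inv_inv x := residue_sigma_ext (P := fun e => Δ.residues (𝒢.eset e) N) (Λ.inv_inv x.1) rfl
  inv_ne x h := Λ.inv_ne x.1 (congrArg Sigma.fst h)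
  origin_inv x := residue_sigma_ext (P := fun v => Δ.residues (𝒢.vset v) N)
    (Λ.origin_inv x.1)
    (congrArg (fun v => Δ.enlarge (𝒢.vset v) x.2) (Λ.origin_inv x.1))

end SpecialGraph

/-!
Both implications come from solving difference equations `h (t e) = h (o e) * f e` on graphs.

Suppose `τ` is an isomorphism. Since `τ` identifies the elements of `F(𝒢, Λ)` along paths from `x₀`
to `v` with `W`, a crossed homomorphism on `F(𝒢, Λ)` that is trivial on the vertex groups solves the
equation for every right-hand side on the edges `w W_{S_e}` of the residue graph of `W` itself.
Pulling the solutions back along the retraction of `Δ` onto `W` centred at a chamber of a given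
edge, one obtains a function on the vertices of the residue graph of `Δ` that changes along this
edge and its inverse only. So every edge separates, and there are no circuits.

Conversely, on a tree the equation is solvable with values in any group, in particular in
`F(𝒢, Λ)`. This gives a development: if the path of an element `x` of the fundamental group is
followed in the residue graph, starting at the centre `c₀` of the retraction, then it ends at a
chamber with retraction `τ x`, and the development is multiplied by `x`. If `τ x = 1` that chamber
is `c₀`, so `x = 1`.

That `τ` is surjective exactly when the `S_v` cover `S` rests on the geometric representation: an
element of `W_J` does not change the coordinates outside `J`.
-/

/-! ### The geometric representation -/

section GeometricRepresentation

open Module Polynomial.Chebyshev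

theorem chebyshev_S_eval_eq_zero {k : ℕ} (hk : 2 ≤ k) :
    (S ℝ (k - 1)).eval (2 * Real.cos (Real.pi / k)) = 0 := by
  have hk0 : (0 : ℝ) < k := by positivity
  have hsin : Real.sin (Real.pi / k) ≠ 0 :=
    (Real.sin_pos_of_pos_of_lt_pi (by positivity)
      (div_lt_self Real.pi_pos (by exact_mod_cast hk))).ne'
  refine (mul_eq_zero.1 ?_).resolve_right hsin
  rw [S_two_mul_real_cos]
  push_cast
  rw [sub_add_cancel, mul_div_cancel₀ _ hk0.ne', Real.sin_pi]

theorem chebyshev_S_eval_add_eval_eq_zero {k : ℕ} (hk : 1 ≤ k) :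
    (S ℝ k).eval (2 * Real.cos (2 * Real.pi / (2 * k + 1))) +
      (S ℝ (k - 1)).eval (2 * Real.cos (2 * Real.pi / (2 * k + 1))) = 0 := by
  set φ := 2 * Real.pi / (2 * k + 1) with hφ
  have hk1 : (1 : ℝ) ≤ k := by exact_mod_cast hk
  have hsin : Real.sin φ ≠ 0 := by
    refine (Real.sin_pos_of_pos_of_lt_pi (by positivity) ?_).ne'
    rw [hφ, div_lt_iff₀ (by positivity)]
    nlinarith [Real.pi_pos]
  have hsum : ((k : ℝ) + 1) * φ = 2 * Real.pi - k * φ := by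
    rw [hφ]
    field_simp
    ring
  refine (mul_eq_zero.1 ?_).resolve_right hsin
  rw [add_mul, S_two_mul_real_cos, S_two_mul_real_cos]
  push_cast
  rw [sub_add_cancel, hsum, Real.sin_two_pi_sub, neg_add_cancel]

theorem reflection_mul_reflection_pow_eq_one {U : Type*} [AddCommGroup U] [Module ℝ U]
    {x y : U} {f g : Dual ℝ U} (hf : f x = 2) (hg : g y = 2) {m : ℕ} (hm : m ≠ 1)
    (hfy : f y = -2 * Real.cos (Real.pi / m)) (hgx : g x = -2 * Real.cos (Real.pi / m)) :
    (reflection hf * reflection hg) ^ m = 1 := by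
  have ht : 2 * Real.cos (2 * Real.pi / m) = f y * g x - 2 := by
    rw [hfy, hgx, mul_div_assoc, Real.cos_two_mul]
    ring
  ext z
  rw [reflection_mul_reflection_pow_apply hf hg m z _ ht, LinearEquiv.coe_one, id]
  obtain ⟨k, rfl | rfl⟩ := Nat.even_or_odd' m
  · rcases (by omega : k = 0 ∨ k = 1 ∨ 2 ≤ k) with rfl | rfl | hk
    · simp
    · have hfy0 : f y = 0 := by simp [hfy]
      have hgx0 : g x = 0 := by simp [hgx]
      simp only [hfy0, hgx0]
      norm_num
      module
    · have h₁ : (((2 * k : ℕ) : ℤ) - 2) / 2 = k - 1 := by omega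
      have h₂ : (((2 * k : ℕ) : ℤ) - 1) / 2 = k - 1 := by omega
      have hφ : 2 * Real.pi / (2 * k : ℕ) = Real.pi / k := by
        push_cast
        rw [mul_div_mul_left _ _ two_ne_zero]
      rw [h₁, h₂, hφ, chebyshev_S_eval_eq_zero hk]
      simp
  · have h₁ : (((2 * k + 1 : ℕ) : ℤ) - 1) / 2 = k := by omega
    have h₂ : (((2 * k + 1 : ℕ) : ℤ) - 3) / 2 = k - 1 := by omega
    have h₃ : ((2 * k + 1 : ℕ) : ℤ) / 2 = k := by omega
    have h₄ : (((2 * k + 1 : ℕ) : ℤ) - 2) / 2 = k - 1 := by omega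
    rw [h₁, h₂, h₃, h₄]
    push_cast
    rw [chebyshev_S_eval_add_eval_eq_zero (by omega)]
    simp

variable {B : Type*} (M : CoxeterMatrix B)

/-- The simple coroot `v ↦ 2 ⟨αᵢ, v⟩` on the space with basis the simple roots `αᵢ`, for the
symmetric bilinear form `⟨αᵢ, αⱼ⟩ = -cos (π / M i j)`; here `M i j = 0` stands for `∞`, and
`π / 0 = 0` gives the value `-1` of the form that is customary in this case. -/
noncomputable def simpleCoroot (i : B) : Dual ℝ (B →₀ ℝ) :=
  Finsupp.linearCombination ℝ fun j => -2 * Real.cos (Real.pi / M i j)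

theorem simpleCoroot_single (i j : B) :
    simpleCoroot M i (Finsupp.single j 1) = -2 * Real.cos (Real.pi / M i j) := by
  simp [simpleCoroot]

theorem simpleCoroot_single_self (i : B) : simpleCoroot M i (Finsupp.single i 1) = 2 := by
  simp [simpleCoroot_single]

/-- The reflection `v ↦ v - 2 ⟨αᵢ, v⟩ αᵢ` by which the simple reflection `sᵢ` acts in the geometric
representation. -/
noncomputable def geometricReflection (i : B) : (B →₀ ℝ) ≃ₗ[ℝ] (B →₀ ℝ) :=
  reflection (simpleCoroot_single_self M i)

theorem geometricReflection_apply (i : B) (v : B →₀ ℝ) :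
    geometricReflection M i v = v - simpleCoroot M i v • Finsupp.single i 1 :=
  reflection_apply v (simpleCoroot_single_self M i)

theorem geometricReflection_apply_of_ne {i j : B} (hij : j ≠ i) (v : B →₀ ℝ) :
    geometricReflection M j v i = v i := by
  simp [geometricReflection_apply, hij]

theorem isLiftable_geometricReflection : M.IsLiftable (geometricReflection M) := by
  intro i j
  rcases eq_or_ne i j with rfl | hij
  · rw [M.diagonal, pow_one, mul_eq_one_iff_eq_inv, geometricReflection, reflection_inv]
  · refine reflection_mul_reflection_pow_eq_one _ _ (M.off_diagonal i j hij)
      (simpleCoroot_single M i j) ?_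
    rw [simpleCoroot_single, M.symmetric]

variable {M} {W : Type*} [Group W] (cs : CoxeterSystem M W)

/-- The geometric representation of a Coxeter group. -/
noncomputable def geometricRep : W →* (B →₀ ℝ) ≃ₗ[ℝ] (B →₀ ℝ) :=
  cs.lift ⟨geometricReflection M, isLiftable_geometricReflection M⟩

theorem geometricRep_simple (i : B) : geometricRep cs (cs.simple i) = geometricReflection M i :=
  cs.lift_apply_simple (isLiftable_geometricReflection M) i

theorem geometricRep_apply_of_mem_specialSubgroup {J : Set B} {i : B} (hi : i ∉ J) {w : W}
    (hw : w ∈ specialSubgroup cs J) (v : B →₀ ℝ) : geometricRep cs w v i = v i := by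
  induction hw using Subgroup.closure_induction generalizing v with
  | mem _ hx =>
    obtain ⟨j, hj, rfl⟩ := hx
    rw [geometricRep_simple, geometricReflection_apply_of_ne M (ne_of_mem_of_not_mem hj hi)]
  | one => simp
  | mul x y _ _ ihx ihy => rw [map_mul, LinearEquiv.mul_apply, ihx, ihy]
  | inv x _ ih =>
    rw [← ih, ← LinearEquiv.mul_apply, ← map_mul, mul_inv_cancel, map_one, LinearEquiv.coe_one, id]

theorem mem_of_simple_mem_specialSubgroup {J : Set B} {i : B}
    (h : cs.simple i ∈ specialSubgroup cs J) : i ∈ J := by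
  by_contra hi
  have hfix := geometricRep_apply_of_mem_specialSubgroup cs hi h (Finsupp.single i 1)
  rw [geometricRep_simple, geometricReflection_apply, simpleCoroot_single_self] at hfix
  norm_num at hfix

end GeometricRepresentation

/-! ### Potentials on Serre graphs -/

namespace SerreGraph

variable {V : Type*} {E : Type*} {G : SerreGraph V E}

theorem isPath_append {u v : V} {p q : List E} :
    G.IsPath u (p ++ q) v ↔ ∃ w, G.IsPath u p w ∧ G.IsPath w q v := by
  induction p generalizing u with
  | nil => simp [IsPath]
  | cons e p ih => simp [IsPath, ih, and_assoc]

theorem isPath_singleton {u v : V} {e : E} :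
    G.IsPath u [e] v ↔ G.origin e = u ∧ G.terminus e = v := by
  simp [IsPath]

theorem IsPath.append {u v w : V} {p q : List E} (hp : G.IsPath u p v) (hq : G.IsPath v q w) :
    G.IsPath u (p ++ q) w :=
  isPath_append.2 ⟨v, hp, hq⟩

theorem IsPath.reverse {u v : V} {p : List E} (h : G.IsPath u p v) :
    G.IsPath v (p.map G.inv).reverse u := by
  induction p generalizing u with
  | nil => exact h.symm
  | cons e p ih =>
    rw [List.map_cons, List.reverse_cons]
    exact (ih h.2).append (isPath_singleton.2 ⟨G.origin_inv e, (G.terminus_inv e).trans h.1⟩)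

theorem IsPath.remove_backtrack {u v : V} {p q : List E} {e : E}
    (h : G.IsPath u (p ++ e :: G.inv e :: q) v) : G.IsPath u (p ++ q) v := by
  obtain ⟨w, hp, rfl, -, hq⟩ := isPath_append.1 h
  rw [G.terminus_inv] at hq
  exact hp.append hq

theorem IsPath.apply_eq {X : Type*} {h : V → X} {u v : V} {p : List E} (hp : G.IsPath u p v)
    (hh : ∀ e ∈ p, h (G.origin e) = h (G.terminus e)) : h u = h v := by
  induction p generalizing u with
  | nil => rw [show u = v from hp]
  | cons e p ih =>
    obtain ⟨rfl, hp⟩ := hp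
    rw [hh e List.mem_cons_self, ih hp fun f hf => hh f (List.mem_cons_of_mem e hf)]

theorem exists_backtrack_of_not_isChain {p : List E} (h : ¬ p.IsChain fun e f => f ≠ G.inv e) :
    ∃ q e r, p = q ++ e :: G.inv e :: r := by
  simp only [List.isChain_iff_forall_rel_of_append_cons_cons, not_forall, not_not] at h
  obtain ⟨e, f, q, r, rfl, rfl⟩ := h
  exact ⟨q, e, r, rfl⟩

theorem exists_terminus_eq_of_not_nodup {p : List E} (h : ¬ (p.map G.terminus).Nodup) :
    ∃ q e r f s, p = q ++ e :: (r ++ f :: s) ∧ G.terminus e = G.terminus f := by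
  induction p with
  | nil => simp at h
  | cons e p ih =>
    rw [List.map_cons, List.nodup_cons, not_and_or, not_not] at h
    rcases h with h | h
    · obtain ⟨f, hf, hfe⟩ := List.mem_map.1 h
      obtain ⟨r, s, rfl⟩ := List.append_of_mem hf
      exact ⟨[], e, r, f, s, rfl, hfe.symm⟩
    · obtain ⟨q, e', r, f, s, rfl, hef⟩ := ih h
      exact ⟨e :: q, e', r, f, s, rfl, hef⟩

theorem eq_nil_of_isPath_self_of_isChain (hG : ∀ p, ¬ G.IsCircuit p) {u : V} {p : List E}
    (hp : G.IsPath u p u) (hchain : p.IsChain fun e f => f ≠ G.inv e) : p = [] := by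
  induction hn : p.length using Nat.strong_induction_on generalizing p u with
  | _ n ih =>
    by_contra hne
    have hnd : ¬ (p.map G.terminus).Nodup := fun hnd => hG p ⟨hne, ⟨u, hp⟩, hchain, hnd⟩
    obtain ⟨q, e, r, f, s, rfl, hef⟩ := exists_terminus_eq_of_not_nodup hnd
    obtain ⟨_, -, -, h⟩ := isPath_append.1 hp
    obtain ⟨_, hr, hf, -⟩ := isPath_append.1 h
    have hclosed : G.IsPath (G.terminus e) (r ++ [f]) (G.terminus e) :=
      hr.append (isPath_singleton.2 ⟨hf, hef.symm⟩)
    have hsegment : r ++ [f] <:+: q ++ e :: (r ++ f :: s) := ⟨q ++ [e], s, by simp⟩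
    have hnil := ih _ (by simp [← hn]; omega) hclosed (hchain.infix hsegment) rfl
    simp at hnil

theorem IsCircuit.notMem_tail {e : E} {p : List E} (h : G.IsCircuit (e :: p)) :
    e ∉ p ∧ G.inv e ∉ p := by
  obtain ⟨-, ⟨u, -, hp⟩, hchain, hnd⟩ := h
  have he : G.terminus e ∉ p.map G.terminus := (List.nodup_cons.1 hnd).1
  refine ⟨fun hmem => he (List.mem_map_of_mem hmem), fun hmem => ?_⟩
  obtain ⟨q, r, rfl⟩ := List.append_of_mem hmem
  obtain rfl | ⟨q, f, rfl⟩ := List.eq_nil_or_concat q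
  · exact (List.isChain_cons_cons.1 hchain).1 rfl
  · rw [List.concat_eq_append, List.append_assoc] at hp he
    obtain ⟨_, -, -, hf, -⟩ := isPath_append.1 hp
    rw [G.origin_inv] at hf
    simp [hf] at he

theorem not_isCircuit_of_forall_exists_cut {X : Type*}
    (hG : ∀ e, ∃ h : V → X, h (G.origin e) ≠ h (G.terminus e) ∧
      ∀ f, f ≠ e → f ≠ G.inv e → h (G.origin f) = h (G.terminus f))
    (p : List E) : ¬ G.IsCircuit p := by
  intro hp
  obtain ⟨e, p, rfl⟩ := List.exists_cons_of_ne_nil hp.1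
  obtain ⟨⟨u, rfl, hpath⟩, he, he'⟩ := And.intro hp.2.1 hp.notMem_tail
  obtain ⟨h, hne, hh⟩ := hG e
  exact hne (hpath.apply_eq fun f hf =>
    hh f (ne_of_mem_of_not_mem hf he) (ne_of_mem_of_not_mem hf he')).symm

section

variable {A : Type*} [Group A] {f : E → A}

theorem prod_map_reverse (hf : ∀ e, f (G.inv e) = (f e)⁻¹) (p : List E) :
    ((p.map G.inv).reverse.map f).prod = (p.map f).prod⁻¹ := by
  rw [List.prod_inv_reverse, List.map_map, List.map_reverse, List.map_map]
  simp only [Function.comp_def, hf]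

theorem prod_map_eq_one_of_isPath_self (hG : ∀ p, ¬ G.IsCircuit p)
    (hf : ∀ e, f (G.inv e) = (f e)⁻¹) {u : V} {p : List E} (hp : G.IsPath u p u) :
    (p.map f).prod = 1 := by
  induction hn : p.length using Nat.strong_induction_on generalizing p with
  | _ n ih =>
    by_cases hchain : p.IsChain fun e f => f ≠ G.inv e
    · rw [eq_nil_of_isPath_self_of_isChain hG hp hchain, List.map_nil, List.prod_nil]
    · obtain ⟨q, e, r, rfl⟩ := exists_backtrack_of_not_isChain hchain
      simpa [hf] using ih _ (by simp [← hn]) hp.remove_backtrack rfl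

theorem IsTree.exists_potential (hG : G.IsTree) (hf : ∀ e, f (G.inv e) = (f e)⁻¹) :
    ∃ h : V → A, ∀ e, h (G.terminus e) = h (G.origin e) * f e := by
  obtain ⟨⟨⟨u⟩, hconn⟩, hcirc⟩ := hG
  choose p hp using hconn u
  refine ⟨fun v => ((p v).map f).prod, fun e => ?_⟩
  have hclosed : G.IsPath u
      (p (G.origin e) ++ [e] ++ ((p (G.terminus e)).map G.inv).reverse) u :=
    ((hp _).append (isPath_singleton.2 ⟨rfl, rfl⟩)).append (hp _).reverse
  have hprod := prod_map_eq_one_of_isPath_self hcirc hf hclosed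
  rw [List.map_append, List.map_append, List.prod_append, List.prod_append, List.map_singleton,
    List.prod_singleton, prod_map_reverse hf, mul_inv_eq_one] at hprod
  exact hprod.symm

end

end SerreGraph

/-! ### Residues and retractions -/

theorem simple_mem_specialSubgroup {B W : Type*} [Group W] {M : CoxeterMatrix B}
    (cs : CoxeterSystem M W) {J : Set B} {i : B} (hi : i ∈ J) :
    cs.simple i ∈ specialSubgroup cs J :=
  Subgroup.subset_closure ⟨i, hi, rfl⟩

@[elab_as_elim]
theorem specialSubgroup_induction {B W : Type*} [Group W] {M : CoxeterMatrix B}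
    {cs : CoxeterSystem M W} {J : Set B} {p : (w : W) → w ∈ specialSubgroup cs J → Prop}
    (one : p 1 (one_mem _))
    (simple_mul : ∀ i (hi : i ∈ J) w (hw : w ∈ specialSubgroup cs J), p w hw →
      p (cs.simple i * w) (mul_mem (simple_mem_specialSubgroup cs hi) hw))
    {w : W} (hw : w ∈ specialSubgroup cs J) : p w hw := by
  induction hw using Subgroup.closure_induction_left with
  | one => exact one
  | mul_left _ hx w hw ih =>
    obtain ⟨i, hi, rfl⟩ := hx
    exact simple_mul i hi w hw ih
  | inv_mul_cancel _ hx w hw ih =>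
    obtain ⟨i, hi, rfl⟩ := hx
    simpa only [cs.inv_simple] using simple_mul i hi w hw ih

namespace Building

variable {B : Type*} {W : Type*} [Group W] {M : CoxeterMatrix B} {cs : CoxeterSystem M W}
  {C : Type*} {Δ : Building cs C}

theorem δ_mem_symm {J : Set B} {c d : C} (h : Δ.δ c d ∈ specialSubgroup cs J) :
    Δ.δ d c ∈ specialSubgroup cs J :=
  Δ.Res_eq_iff.1 (Δ.Res_eq_iff.2 h).symm

theorem δ_mem_trans {J : Set B} {c d e : C} (hcd : Δ.δ c d ∈ specialSubgroup cs J)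
    (hde : Δ.δ d e ∈ specialSubgroup cs J) : Δ.δ c e ∈ specialSubgroup cs J :=
  Δ.Res_eq_iff.1 ((Δ.Res_eq_iff.2 hcd).trans (Δ.Res_eq_iff.2 hde))

variable (Δ)

theorem exists_residue_map {ι X : Type*} {J : ι → Set B} {g : ι → C → X}
    (hg : ∀ i c d, Δ.δ c d ∈ specialSubgroup cs (J i) → g i c = g i d) :
    ∃ h : (Σ i, Δ.residues (J i) Set.univ) → X,
      ∀ i c, h ⟨i, Δ.Res (J i) c, c, Set.mem_univ c, rfl⟩ = g i c := by
  have := Δ.nonempty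
  exact ⟨fun x => g x.1 (Function.invFun (Δ.Res (J x.1)) x.2), fun i c =>
    hg i _ c (Δ.Res_eq_iff.1 (Function.invFun_eq ⟨c, rfl⟩))⟩

/-- The retraction of the building onto `W` centred at the chamber `c₀`, with the standard
apartment identified with `W` so that `c₀` corresponds to `1`. -/
def retract (c₀ c : C) : W :=
  (Δ.δ c c₀)⁻¹

theorem retract_eq_one_iff {c₀ c : C} : Δ.retract c₀ c = 1 ↔ c = c₀ := by
  rw [retract, inv_eq_one, Δ.δ_eq_one_iff]

theorem retract_mem_iff {c₀ c : C} {J : Set B} :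
    Δ.retract c₀ c ∈ specialSubgroup cs J ↔ Δ.δ c c₀ ∈ specialSubgroup cs J :=
  inv_mem_iff

theorem retract_of_adj (c₀ : C) {c' c : C} {i : B} (h : Δ.δ c' c = cs.simple i) :
    Δ.retract c₀ c' = Δ.retract c₀ c * cs.simple i ∨ Δ.retract c₀ c' = Δ.retract c₀ c := by
  rcases Δ.δ_of_adj i c' c c₀ h with h | h
  · left; simp [retract, h]
  · right; simp [retract, h]

theorem exists_adj_retract (c₀ c : C) (i : B) :
    ∃ c', Δ.δ c' c = cs.simple i ∧ Δ.retract c₀ c' = Δ.retract c₀ c * cs.simple i := by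
  obtain ⟨c', h1, h2⟩ := Δ.exists_adj i c c₀
  exact ⟨c', h1, by simp [retract, h2]⟩

theorem retract_inv_mul_mem (c₀ : C) {J : Set B} {c d : C}
    (h : Δ.δ c d ∈ specialSubgroup cs J) :
    (Δ.retract c₀ c)⁻¹ * Δ.retract c₀ d ∈ specialSubgroup cs J := by
  generalize hw : Δ.δ c d = w at h
  induction h using specialSubgroup_induction generalizing c with
  | one =>
    rw [(Δ.δ_eq_one_iff c d).1 hw, inv_mul_cancel]
    exact one_mem _
  | simple_mul i hi w _ ih =>
    obtain ⟨c', hadj, hd⟩ := Δ.exists_adj i c d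
    have hmem := ih (by rw [hd, hw, cs.simple_mul_simple_cancel_left])
    rcases Δ.retract_of_adj c₀ hadj with h | h
    · rw [h, mul_inv_rev, cs.inv_simple, mul_assoc] at hmem
      exact ((specialSubgroup cs J).mul_mem_cancel_left (simple_mem_specialSubgroup cs hi)).1 hmem
    · rwa [h] at hmem

theorem exists_retract_eq_mul (c₀ c : C) {J : Set B} {a : W} (ha : a ∈ specialSubgroup cs J) :
    ∃ d, Δ.δ c d ∈ specialSubgroup cs J ∧ Δ.retract c₀ d = Δ.retract c₀ c * a := by
  induction ha using specialSubgroup_induction generalizing c with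
  | one => exact ⟨c, Δ.mem_Res_self J c, by rw [mul_one]⟩
  | simple_mul i hi w _ ih =>
    obtain ⟨c', hadj, hc'⟩ := Δ.exists_adj_retract c₀ c i
    have hmem : Δ.δ c' c ∈ specialSubgroup cs J := by
      rw [hadj]
      exact simple_mem_specialSubgroup cs hi
    obtain ⟨d, hd, hdw⟩ := ih c'
    exact ⟨d, δ_mem_trans (δ_mem_symm hmem) hd, by rw [hdw, hc', mul_assoc]⟩

theorem exists_residue_coordinate (c₀ : C) (J : Set B) :
    ∃ k : C → specialSubgroup cs J, ∀ c d (a : specialSubgroup cs J),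
      Δ.δ c d ∈ specialSubgroup cs J → Δ.retract c₀ d = Δ.retract c₀ c * a → k d = k c * a := by
  have := Δ.nonempty
  let r (c : C) : C := Function.invFun (Δ.Res J) (Δ.Res J c)
  have hr (c : C) : Δ.δ (r c) c ∈ specialSubgroup cs J :=
    Δ.Res_eq_iff.1 (Function.invFun_eq ⟨c, rfl⟩)
  refine ⟨fun c => ⟨_, Δ.retract_inv_mul_mem c₀ (hr c)⟩, fun c d a h ha => Subtype.ext ?_⟩
  have hrd : r d = r c := by simp only [r, Δ.Res_eq_iff.2 h]
  simp only [hrd, ha, Subgroup.coe_mul, mul_assoc]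

end Building

/-! ### The residue graph -/

namespace SpecialGraph

variable {B : Type*} {W : Type*} [Group W] {M : CoxeterMatrix B} {cs : CoxeterSystem M W}
  {C : Type*} {V E : Type*} {Λ : SerreGraph V E} (𝒢 : SpecialGraph B Λ) (Δ : Building cs C)

/-- The vertex `Res_{S_v}(c)` of the residue graph, in the copy indexed by `v`. -/
def vtx (v : V) (c : C) : 𝒢.ResidueVertex Δ Set.univ :=
  ⟨v, Δ.Res (𝒢.vset v) c, c, Set.mem_univ c, rfl⟩

/-- The edge `Res_{S_e}(c)` of the residue graph, in the copy indexed by `e`. -/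
def edg (e : E) (c : C) : 𝒢.ResidueEdge Δ Set.univ :=
  ⟨e, Δ.Res (𝒢.eset e) c, c, Set.mem_univ c, rfl⟩

variable {𝒢 Δ}

theorem vtx_eq_of_δ_mem {v : V} {c d : C} (h : Δ.δ c d ∈ specialSubgroup cs (𝒢.vset v)) :
    𝒢.vtx Δ v c = 𝒢.vtx Δ v d :=
  residue_sigma_ext (P := fun v => Δ.residues (𝒢.vset v) Set.univ) rfl (Δ.Res_eq_of_δ_mem h)

theorem edg_eq_of_δ_mem {e : E} {c d : C} (h : Δ.δ c d ∈ specialSubgroup cs (𝒢.eset e)) :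
    𝒢.edg Δ e c = 𝒢.edg Δ e d :=
  residue_sigma_ext (P := fun e => Δ.residues (𝒢.eset e) Set.univ) rfl (Δ.Res_eq_of_δ_mem h)

@[simp]
theorem origin_edg (e : E) (c : C) :
    (𝒢.residueGraph Δ Set.univ).origin (𝒢.edg Δ e c) = 𝒢.vtx Δ (Λ.origin e) c :=
  residue_sigma_ext (P := fun v => Δ.residues (𝒢.vset v) Set.univ) rfl
    (Δ.enlarge_Res (𝒢.eset_subset_origin e) c)

@[simp]
theorem terminus_edg (e : E) (c : C) :
    (𝒢.residueGraph Δ Set.univ).terminus (𝒢.edg Δ e c) = 𝒢.vtx Δ (Λ.terminus e) c :=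
  residue_sigma_ext (P := fun v => Δ.residues (𝒢.vset v) Set.univ) rfl
    (Δ.enlarge_Res (𝒢.eset_subset e) c)

@[simp]
theorem inv_edg (e : E) (c : C) :
    (𝒢.residueGraph Δ Set.univ).inv (𝒢.edg Δ e c) = 𝒢.edg Δ (Λ.inv e) c :=
  residue_sigma_ext (P := fun e => Δ.residues (𝒢.eset e) Set.univ) rfl
    (by rw [𝒢.eset_inv]; rfl)

theorem exists_eq_vtx (x : 𝒢.ResidueVertex Δ Set.univ) : ∃ v c, x = 𝒢.vtx Δ v c := by
  obtain ⟨v, _, c, -, rfl⟩ := x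
  exact ⟨v, c, rfl⟩

theorem exists_eq_edg (x : 𝒢.ResidueEdge Δ Set.univ) : ∃ e c, x = 𝒢.edg Δ e c := by
  obtain ⟨e, _, c, -, rfl⟩ := x
  exact ⟨e, c, rfl⟩

theorem exists_map_vtx {X : Type*} {g : V → C → X}
    (hg : ∀ v c d, Δ.δ c d ∈ specialSubgroup cs (𝒢.vset v) → g v c = g v d) :
    ∃ h : 𝒢.ResidueVertex Δ Set.univ → X, ∀ v c, h (𝒢.vtx Δ v c) = g v c :=
  Δ.exists_residue_map hg

theorem exists_map_edg {X : Type*} {g : E → C → X}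
    (hg : ∀ e c d, Δ.δ c d ∈ specialSubgroup cs (𝒢.eset e) → g e c = g e d) :
    ∃ h : 𝒢.ResidueEdge Δ Set.univ → X, ∀ e c, h (𝒢.edg Δ e c) = g e c :=
  Δ.exists_residue_map hg

theorem isPath_map_edg {u v : V} {p : List E} (h : Λ.IsPath u p v) (c : C) :
    (𝒢.residueGraph Δ Set.univ).IsPath (𝒢.vtx Δ u c) (p.map fun e => 𝒢.edg Δ e c)
      (𝒢.vtx Δ v c) := by
  induction p generalizing u with
  | nil => cases h; rfl
  | cons e p ih =>
    obtain ⟨rfl, h⟩ := h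
    exact ⟨origin_edg e c, by rw [terminus_edg]; exact ih h⟩

theorem residueGraph_connected (hS : (⋃ v, 𝒢.vset v) = Set.univ) :
    (𝒢.residueGraph Δ Set.univ).Connected := by
  obtain ⟨⟨v₀⟩, hΛ⟩ := 𝒢.connected
  obtain ⟨c₀⟩ := Δ.nonempty
  refine ⟨⟨𝒢.vtx Δ v₀ c₀⟩, fun x y => ?_⟩
  obtain ⟨u, c, rfl⟩ := exists_eq_vtx x
  obtain ⟨v, d, rfl⟩ := exists_eq_vtx y
  generalize hw : Δ.δ c d = w
  induction w using cs.simple_induction_left generalizing u c with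
  | one =>
    rw [(Δ.δ_eq_one_iff c d).1 hw]
    obtain ⟨p, hp⟩ := hΛ u v
    exact ⟨_, isPath_map_edg hp d⟩
  | mul_simple_left w i ih =>
    obtain ⟨c', hadj, hd⟩ := Δ.exists_adj i c d
    obtain ⟨x, hx⟩ := Set.mem_iUnion.1 (hS ▸ Set.mem_univ i)
    have hvtx : 𝒢.vtx Δ x c' = 𝒢.vtx Δ x c :=
      vtx_eq_of_δ_mem (hadj ▸ simple_mem_specialSubgroup cs hx)
    obtain ⟨p, hp⟩ := hΛ u x
    obtain ⟨q, hq⟩ := ih x c' (by rw [hd, hw, cs.simple_mul_simple_cancel_left])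
    rw [hvtx] at hq
    exact ⟨_, (isPath_map_edg hp c).append hq⟩

/-! #### Words along paths -/

@[simp]
theorem pathTau_vertexElt (v : V) (a : specialSubgroup cs (𝒢.vset v)) :
    𝒢.pathTau cs (𝒢.vertexElt cs v a) = a :=
  𝒢.preTau_preVertex cs v a

@[simp]
theorem pathTau_edgeElt (e : E) : 𝒢.pathTau cs (𝒢.edgeElt cs e) = 1 :=
  𝒢.preTau_preEdge cs e

theorem vertexElt_mul_edgeElt (e : E) {a : W} (ha : a ∈ specialSubgroup cs (𝒢.eset e)) :
    𝒢.vertexElt cs (Λ.origin e) ⟨a, specialSubgroup_mono cs (𝒢.eset_subset_origin e) ha⟩ *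
        𝒢.edgeElt cs e =
      𝒢.edgeElt cs e *
        𝒢.vertexElt cs (Λ.terminus e) ⟨a, specialSubgroup_mono cs (𝒢.eset_subset e) ha⟩ := by
  rw [eq_comm, ← mul_inv_eq_iff_eq_mul, ← mul_inv_eq_one]
  exact (QuotientGroup.eq_one_iff _).2
    (Subgroup.subset_normalClosure (Or.inr ⟨e, a, ha, rfl⟩))

theorem IsPathWord.edge (𝒢 : SpecialGraph B Λ) (cs : CoxeterSystem M W) (e : E) :
    𝒢.IsPathWord cs (Λ.origin e) (Λ.terminus e) (𝒢.edgeElt cs e) := by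
  simpa using (IsPathWord.edge_inv 𝒢 cs e).inv

variable (𝒢 cs) in
theorem exists_isPathWord_pathTau_eq_one (u v : V) :
    ∃ y, 𝒢.IsPathWord cs u v y ∧ 𝒢.pathTau cs y = 1 := by
  obtain ⟨p, hp⟩ := 𝒢.connected.2 u v
  induction p generalizing u with
  | nil =>
    cases hp
    exact ⟨_, .nil _ 1, by rw [pathTau_vertexElt, OneMemClass.coe_one]⟩
  | cons e p ih =>
    obtain ⟨rfl, hp⟩ := hp
    obtain ⟨y, hy, hτ⟩ := ih _ hp
    exact ⟨_, .cons e 1 _ y hy, by simp [hτ]⟩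

theorem IsPathWord.pathTau_mem {u v : V} {x : 𝒢.PathGroup cs} (h : 𝒢.IsPathWord cs u v x) :
    𝒢.pathTau cs x ∈ specialSubgroup cs (⋃ v, 𝒢.vset v) := by
  have hv (v : V) (a : specialSubgroup cs (𝒢.vset v)) :
      (a : W) ∈ specialSubgroup cs (⋃ v, 𝒢.vset v) :=
    specialSubgroup_mono cs (Set.subset_iUnion _ v) a.2
  induction h with
  | nil v a => simpa using hv v a
  | cons e a w x h ih =>
    rw [map_mul, map_mul, pathTau_vertexElt, pathTau_edgeElt, mul_one]
    exact mul_mem (hv _ a) ih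

theorem tau_surjective_iff {x₀ : V} :
    Function.Surjective (𝒢.tau cs x₀) ↔ (⋃ v, 𝒢.vset v) = Set.univ := by
  constructor
  · refine fun h => Set.eq_univ_of_forall fun i => ?_
    obtain ⟨⟨x, hx⟩, hxi⟩ := h (cs.simple i)
    exact mem_of_simple_mem_specialSubgroup cs (hxi ▸ IsPathWord.pathTau_mem hx)
  · intro h
    rw [← MonoidHom.range_eq_top, eq_top_iff, ← cs.subgroup_closure_range_simple,
      Subgroup.closure_le]
    rintro _ ⟨i, rfl⟩
    obtain ⟨v, hv⟩ := Set.mem_iUnion.1 (h ▸ Set.mem_univ i)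
    obtain ⟨y, hy, hτ⟩ := 𝒢.exists_isPathWord_pathTau_eq_one cs x₀ v
    exact ⟨⟨_, (hy.mul (.nil v ⟨_, simple_mem_specialSubgroup cs hv⟩)).mul hy.inv⟩,
      by simp [tau, hτ]⟩

theorem exists_isPathWord_pathTau_eq {x₀ : V} (hτ : Function.Surjective (𝒢.tau cs x₀)) (v : V)
    (w : W) : ∃ x, 𝒢.IsPathWord cs x₀ v x ∧ 𝒢.pathTau cs x = w := by
  obtain ⟨⟨x, hx⟩, rfl⟩ := hτ w
  obtain ⟨y, hy, hy'⟩ := 𝒢.exists_isPathWord_pathTau_eq_one cs x₀ v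
  exact ⟨x * y, IsPathWord.mul hx hy, by simp [tau, hy']⟩

theorem IsPathWord.eq_of_pathTau_eq {x₀ : V} (hτ : Function.Injective (𝒢.tau cs x₀)) {v : V}
    {x y : 𝒢.PathGroup cs} (hx : 𝒢.IsPathWord cs x₀ v x) (hy : 𝒢.IsPathWord cs x₀ v y)
    (hxy : 𝒢.pathTau cs x = 𝒢.pathTau cs y) : x = y := by
  have hone : (⟨x * y⁻¹, hx.mul hy.inv⟩ : 𝒢.fundamentalGroup cs x₀) = 1 :=
    hτ (by simp [tau, hxy])
  exact mul_inv_eq_one.1 (congrArg Subtype.val hone)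

/-! #### Crossed homomorphisms on the path group -/

section CrossedHom

variable {A : Type*} [Group A] {f : E → W → A}

variable (𝒢 cs) in
/-- The homomorphism from the free product to the unrestricted wreath product of `A` and `W` that
lifts `preTau` and encodes the crossed homomorphism with values `f e` on the edges, trivial on the
vertex groups. The inverse is due to the left translation action of `W` in the wreath product. -/
def preWreath (f : E → W → A) : 𝒢.FreeProd cs →* A ≀ᵣ W :=
  Monoid.Coprod.lift
    (Monoid.CoprodI.lift fun v : V =>
      RegularWreathProduct.inl.comp (specialSubgroup cs (𝒢.vset v)).subtype)
    (FreeGroup.lift fun e => ⟨fun w => f e w⁻¹, 1⟩)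

theorem preWreath_preVertex (f : E → W → A) (v : V) (a : specialSubgroup cs (𝒢.vset v)) :
    𝒢.preWreath cs f (𝒢.preVertex cs v a) = RegularWreathProduct.inl (a : W) := by
  simp [preWreath, preVertex]

theorem preWreath_preEdge (f : E → W → A) (e : E) :
    𝒢.preWreath cs f (𝒢.preEdge cs e) = ⟨fun w => f e w⁻¹, 1⟩ := by
  simp [preWreath, preEdge]

theorem preWreath_right (f : E → W → A) (x : 𝒢.FreeProd cs) :
    (𝒢.preWreath cs f x).right = 𝒢.preTau cs x := by
  have : RegularWreathProduct.rightHom.comp (𝒢.preWreath cs f) = 𝒢.preTau cs := by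
    ext <;> simp [preWreath, preTau]
  exact DFunLike.congr_fun this x

theorem normalClosure_relators_le_ker_preWreath (hinv : ∀ e, f (Λ.inv e) = (f e)⁻¹)
    (hf : ∀ e w, ∀ a ∈ specialSubgroup cs (𝒢.eset e), f e (w * a) = f e w) :
    Subgroup.normalClosure (𝒢.relators cs) ≤ (𝒢.preWreath cs f).ker := by
  refine Subgroup.normalClosure_le_normal ?_
  rintro x (⟨e, rfl⟩ | ⟨e, a, ha, rfl⟩)
  · rw [SetLike.mem_coe, MonoidHom.mem_ker, map_mul, preWreath_preEdge, preWreath_preEdge]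
    ext w <;> simp [hinv]
  · rw [SetLike.mem_coe, MonoidHom.mem_ker, map_mul, map_mul, map_mul, map_inv, map_inv,
      preWreath_preEdge, preWreath_preVertex, preWreath_preVertex, mul_inv_eq_one,
      mul_inv_eq_iff_eq_mul]
    ext w <;> simp [hf e _ a ha]

theorem exists_crossedHom (hinv : ∀ e, f (Λ.inv e) = (f e)⁻¹)
    (hf : ∀ e w, ∀ a ∈ specialSubgroup cs (𝒢.eset e), f e (w * a) = f e w) :
    ∃ L : 𝒢.PathGroup cs → A, (∀ x v a, L (x * 𝒢.vertexElt cs v a) = L x) ∧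
      ∀ x e, L (x * 𝒢.edgeElt cs e) = L x * f e (𝒢.pathTau cs x) := by
  let Φ : 𝒢.PathGroup cs →* A ≀ᵣ W :=
    QuotientGroup.lift _ (𝒢.preWreath cs f) (normalClosure_relators_le_ker_preWreath hinv hf)
  have hvertex v a : Φ (𝒢.vertexElt cs v a) = RegularWreathProduct.inl (a : W) :=
    preWreath_preVertex f v a
  have hedge e : Φ (𝒢.edgeElt cs e) = ⟨fun w => f e w⁻¹, 1⟩ :=
    preWreath_preEdge (cs := cs) (𝒢 := 𝒢) f e
  have hright x : (Φ x).right = 𝒢.pathTau cs x := by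
    obtain ⟨x, rfl⟩ := QuotientGroup.mk_surjective x
    exact preWreath_right f x
  exact ⟨fun x => (Φ x).left 1, fun x v a => by simp [hvertex],
    fun x e => by simp [hedge, hright]⟩

theorem IsVisualDecomposition.exists_potential {x₀ : V} (hτ : 𝒢.IsVisualDecomposition cs x₀)
    (hinv : ∀ e, f (Λ.inv e) = (f e)⁻¹)
    (hf : ∀ e w, ∀ a ∈ specialSubgroup cs (𝒢.eset e), f e (w * a) = f e w) :
    ∃ h : V → W → A, (∀ v w, ∀ a ∈ specialSubgroup cs (𝒢.vset v), h v (w * a) = h v w) ∧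
      ∀ e w, h (Λ.terminus e) w = h (Λ.origin e) w * f e w := by
  obtain ⟨L, hL, hLe⟩ := exists_crossedHom hinv hf
  choose x hx hxτ using exists_isPathWord_pathTau_eq hτ.2
  refine ⟨fun v w => L (x v w), fun v w a ha => ?_, fun e w => ?_⟩
  · have hxa : x v (w * a) = x v w * 𝒢.vertexElt cs v ⟨a, ha⟩ :=
      (hx v _).eq_of_pathTau_eq hτ.1 ((hx v w).mul (.nil v _)) (by simp [hxτ])
    simp only [hxa, hL]
  · have hxe : x (Λ.terminus e) w = x (Λ.origin e) w * 𝒢.edgeElt cs e :=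
      (hx _ w).eq_of_pathTau_eq hτ.1 ((hx _ w).mul (.edge 𝒢 cs e)) (by simp [hxτ])
    simp only [hxe, hLe, hxτ]

end CrossedHom

theorem IsVisualDecomposition.exists_cut {x₀ : V} (hτ : 𝒢.IsVisualDecomposition cs x₀)
    (ε : 𝒢.ResidueEdge Δ Set.univ) :
    ∃ h : 𝒢.ResidueVertex Δ Set.univ → ℤˣ,
      h ((𝒢.residueGraph Δ Set.univ).origin ε) ≠ h ((𝒢.residueGraph Δ Set.univ).terminus ε) ∧
      ∀ η, η ≠ ε → η ≠ (𝒢.residueGraph Δ Set.univ).inv ε →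
        h ((𝒢.residueGraph Δ Set.univ).origin η) =
          h ((𝒢.residueGraph Δ Set.univ).terminus η) := by
  classical
  obtain ⟨e₀, c₀, rfl⟩ := exists_eq_edg ε
  let f (e : E) (w : W) : ℤˣ :=
    if (e = e₀ ∨ e = Λ.inv e₀) ∧ w ∈ specialSubgroup cs (𝒢.eset e) then -1 else 1
  have hinv_iff e : (Λ.inv e = e₀ ∨ Λ.inv e = Λ.inv e₀) ↔ (e = e₀ ∨ e = Λ.inv e₀) := by
    have hinvol : Function.Involutive Λ.inv := Λ.inv_inv
    rw [hinvol.injective.eq_iff, hinvol.eq_iff, or_comm]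
  obtain ⟨h, hconst, hf⟩ := hτ.exists_potential (f := f)
    (fun e => funext fun w => by
      rw [Pi.inv_apply, Int.units_inv_eq_self]; simp only [f, hinv_iff, 𝒢.eset_inv])
    (fun e w a ha => by simp only [f, (specialSubgroup cs (𝒢.eset e)).mul_mem_cancel_right ha])
  obtain ⟨g, hg⟩ := 𝒢.exists_map_vtx (Δ := Δ) (g := fun v c => h v (Δ.retract c₀ c))
    fun v c d hcd => by
      rw [← hconst v _ _ (Δ.retract_inv_mul_mem c₀ hcd), mul_inv_cancel_left]
  refine ⟨g, ?_, fun η hη hη' => ?_⟩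
  · have hfe₀ : f e₀ (Δ.retract c₀ c₀) = -1 :=
      if_pos ⟨Or.inl rfl, by rw [Δ.retract_eq_one_iff.2 rfl]; exact one_mem _⟩
    rw [origin_edg, terminus_edg, hg, hg, hf, hfe₀, mul_neg, mul_one]
    exact units_ne_neg_self _
  · obtain ⟨e, c, rfl⟩ := exists_eq_edg η
    have hfe : f e (Δ.retract c₀ c) = 1 := by
      refine if_neg fun ⟨he, hc⟩ => ?_
      have hcc₀ := edg_eq_of_δ_mem (Δ.retract_mem_iff.1 hc)
      rcases he with rfl | rfl
      · exact hη hcc₀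
      · exact hη' (hcc₀.trans (inv_edg e₀ c₀).symm)
    rw [origin_edg, terminus_edg, hg, hg, hf, hfe, mul_one]

theorem IsVisualDecomposition.isTree {x₀ : V} (h : 𝒢.IsVisualDecomposition cs x₀)
    (Δ : Building cs C) : (𝒢.residueGraph Δ Set.univ).IsTree :=
  ⟨residueGraph_connected (tau_surjective_iff.1 h.2),
    SerreGraph.not_isCircuit_of_forall_exists_cut h.exists_cut⟩

/-! #### Developing a residue tree -/

/-- A development of the residue graph, relative to the retraction centred at `c₀`: a function `H`
assigning an element of `F(𝒢, Λ)` to each pair of a vertex of `Λ` and a chamber, so that moving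
inside a residue of type `S_v`, respectively along an edge of the residue graph, multiplies it by
the corresponding vertex group element, respectively edge. -/
structure IsDevelopment (𝒢 : SpecialGraph B Λ) (Δ : Building cs C) (c₀ : C)
    (H : V → C → 𝒢.PathGroup cs) : Prop where
  mul_vertexElt : ∀ v c d (a : specialSubgroup cs (𝒢.vset v)),
    Δ.δ c d ∈ specialSubgroup cs (𝒢.vset v) →
      Δ.retract c₀ d = Δ.retract c₀ c * a → H v d = H v c * 𝒢.vertexElt cs v a
  mul_edgeElt : ∀ e c, H (Λ.terminus e) c = H (Λ.origin e) c * 𝒢.edgeElt cs e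

-- `K (o e) c * e * (K (t e) c)⁻¹` depends only on the edge `Res_{S_e}(c)`; a potential of this
-- function on the tree corrects `K` to a development.
theorem exists_isDevelopment (hT : (𝒢.residueGraph Δ Set.univ).IsTree) (c₀ : C) :
    ∃ H, 𝒢.IsDevelopment Δ c₀ H := by
  choose k hk using fun v => Δ.exists_residue_coordinate c₀ (𝒢.vset v)
  let K (v : V) (c : C) : 𝒢.PathGroup cs := 𝒢.vertexElt cs v (k v c)
  have hK v c d (a : specialSubgroup cs (𝒢.vset v))
      (hcd : Δ.δ c d ∈ specialSubgroup cs (𝒢.vset v))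
      (ha : Δ.retract c₀ d = Δ.retract c₀ c * a) : K v d = K v c * 𝒢.vertexElt cs v a := by
    simp only [K, hk v c d a hcd ha, 𝒢.vertexElt_mul]
  obtain ⟨F, hF⟩ := 𝒢.exists_map_edg (Δ := Δ)
    (g := fun e c => K (Λ.origin e) c * 𝒢.edgeElt cs e * (K (Λ.terminus e) c)⁻¹)
    fun e c d hcd => by
      have ha := Δ.retract_inv_mul_mem c₀ hcd
      have hd := (mul_inv_cancel_left (Δ.retract c₀ c) (Δ.retract c₀ d)).symm
      have hsub := specialSubgroup_mono cs (𝒢.eset_subset e)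
      have hsub' := specialSubgroup_mono cs (𝒢.eset_subset_origin e)
      rw [hK _ c d ⟨_, hsub ha⟩ (hsub hcd) hd, hK _ c d ⟨_, hsub' ha⟩ (hsub' hcd) hd,
        mul_assoc (K _ c) (𝒢.vertexElt _ _ _), vertexElt_mul_edgeElt e ha]
      group
  obtain ⟨h, hh⟩ := hT.exists_potential (f := F) fun ε => by
    obtain ⟨e, c, rfl⟩ := exists_eq_edg ε
    rw [inv_edg, hF, hF, edgeElt_inv, Λ.origin_inv, Λ.terminus_inv]
    group
  refine ⟨fun v c => h (𝒢.vtx Δ v c) * K v c, fun v c d a hcd ha => ?_, fun e c => ?_⟩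
  · rw [vtx_eq_of_δ_mem hcd, hK v c d a hcd ha, mul_assoc]
  · have hhe := hh (𝒢.edg Δ e c)
    rw [origin_edg, terminus_edg, hF] at hhe
    simp only [hhe]
    group

theorem IsDevelopment.exists_eq_mul {c₀ : C} {H : V → C → 𝒢.PathGroup cs}
    (hH : 𝒢.IsDevelopment Δ c₀ H)
    {u v : V} {x : 𝒢.PathGroup cs} (hx : 𝒢.IsPathWord cs u v x) (c : C) :
    ∃ d, Δ.retract c₀ d = Δ.retract c₀ c * 𝒢.pathTau cs x ∧ H v d = H u c * x := by
  induction hx generalizing c with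
  | nil v a =>
    obtain ⟨d, hcd, hd⟩ := Δ.exists_retract_eq_mul c₀ c a.2
    exact ⟨d, by rw [hd, pathTau_vertexElt], hH.mul_vertexElt v c d a hcd hd⟩
  | cons e a v x _ ih =>
    obtain ⟨c', hcc', hc'⟩ := Δ.exists_retract_eq_mul c₀ c a.2
    obtain ⟨d, hd, hHd⟩ := ih c'
    refine ⟨d, by simp [hd, hc', mul_assoc], ?_⟩
    rw [hHd, hH.mul_edgeElt, hH.mul_vertexElt _ c c' a hcc' hc', mul_assoc, mul_assoc, mul_assoc]

theorem tau_injective_of_isTree (hT : (𝒢.residueGraph Δ Set.univ).IsTree) (x₀ : V) :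
    Function.Injective (𝒢.tau cs x₀) := by
  obtain ⟨c₀⟩ := Δ.nonempty
  obtain ⟨H, hH⟩ := exists_isDevelopment hT c₀
  refine (injective_iff_map_eq_one _).2 fun ⟨x, hx⟩ hτx => Subtype.ext ?_
  obtain ⟨d, hd, hHd⟩ := hH.exists_eq_mul hx c₀
  have hdc₀ : d = c₀ := by
    rw [← Δ.retract_eq_one_iff, hd, Δ.retract_eq_one_iff.2 rfl, one_mul]
    exact hτx
  rwa [hdc₀, left_eq_mul] at hHd

end SpecialGraph

theorem theoremF_general {B : Type*} {W : Type*} [Group W] {M : CoxeterMatrix B}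
    (cs : CoxeterSystem M W) {C : Type*} (Δ : Building cs C)
    {V E : Type*} {Λ : SerreGraph V E} (𝒢 : SpecialGraph B Λ) (x₀ : V) :
    𝒢.IsVisualDecomposition cs x₀ ↔
      (⋃ v, 𝒢.vset v) = Set.univ ∧ (𝒢.residueGraph Δ Set.univ).IsTree :=
  ⟨fun h => ⟨SpecialGraph.tau_surjective_iff.1 h.2, h.isTree Δ⟩,
    fun ⟨hS, hT⟩ => ⟨SpecialGraph.tau_injective_of_isTree hT x₀,
      SpecialGraph.tau_surjective_iff.2 hS⟩⟩

theorem theoremF {B : Type*} [Finite B] {W : Type*} [Group W] {M : CoxeterMatrix B}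
    (cs : CoxeterSystem M W) {C : Type*} (Δ : Building cs C)
    {V E : Type*} {Λ : SerreGraph V E} (𝒢 : SpecialGraph B Λ) (x₀ : V) :
    𝒢.IsVisualDecomposition cs x₀ ↔
      (⋃ v, 𝒢.vset v) = Set.univ ∧ (𝒢.residueGraph Δ Set.univ).IsTree :=
  theoremF_general cs Δ 𝒢 x₀
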